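/- Let $k\ge 1$ be an integer. **Definitions.** A counting measure on a measurable space $S$ is a measure with values in $\{0,1,2,\dots,\infty\}$; a point process on $S$ is a random counting measure, i.e. a measurable map $\mathcal Z$ from a probability space $(\Omega,\mathcal F,\mathbb P)$ to the counting measures on $S$ (with the $\sigma$-algebra generated by the evaluations $\mu\mapsto\mu(A)$); it is $k$-homogeneous if $\mathcal Z(S)=k$ almost surely. The law of a point process stochastically covers the law of another one if there is a coupling of the two laws supported on pairs $(\mu,\nu)$ such that $\mu=\nu$ or $\mu=\nu+\delta_x$ for some $x\in S$. Let $\mathcal Z$ be $k$-homogeneous on a standard Borel space $S$, let $X_1,\dots,X_k$ be its points (with multiplicity) listed in uniformly random order, and let $\mathcal Z_{x_1,\dots,x_j}$ denote a point process whose law is the (regular) conditional law of $\sum_{i=j+1}^k\delta_{X_i}$ given $X_1=x_1,\dots,X_j=x_j$. Then $\mathcal Z$ has the stochastic covering property (SCP) if for every $0\le j<k$ the law of $\mathcal Z_{x_1,\dots,x_j}$ stochastically covers that of $\mathcal Z_{x_1,\dots,x_{j+1}}$, for almost every $(x_1,\dots,x_{j+1})$ with respect to the law of $(X_1,\dots,X_{j+1})$.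 The total variation distance of finite measures is $|\mu-\nu|(S)$. **Theorem.** Let $\mathcal Z$ be a $k$-homogeneous point process on a standard Borel space $S$ that has the SCP. Let $f$ be a measurable real function on the counting measures on $S$ of total mass $k$ that is Lipschitz with constant $1$ for the total variation distance. Then $f=f(\mathcal Z)$ is integrable and, for every real $a\ge 0$, $$\mathbb P\left(f-\mathbb E f\ge a\right)\le \exp\left(-\frac{a^2}{8k}\right).$$ **Discrete case (finite ground set).** Let $\nu$ be a probability measure on $\{0,1\}^n$ with coordinatewise order, supported on the strings with exactly $k$ ones. For finite $I$, say that a probability measure on $\{0,1\}^I$ covers another one if there is a coupling of the two supported on pairs $(x,y)$ with $x=y$ or $x$ covering $y$. Suppose that $\nu$ has the SCP: for every $T\subseteq\{1,\dots,n\}$ and all $x,y\in\{0,1\}^T$ such that $x$ covers $y$ and both conditioning events below have positive probability, the conditional law under $\nu$ of the coordinates outside $T$ given that those in $T$ equal $y$ covers the conditional law given that those in $T$ equal $x$. Let $f:\{0,1\}^n\to\mathbb R$ be Lipschitz with constant $1$ for the Hamming distance. Then for every real $a\ge0$, $$\nu\left(f-\mathbb E_\nu f\ge a\right)\le\exp\left(-\frac{a^2}{8k}\right).$$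 -/

import Mathlib

open MeasureTheory ProbabilityTheory
open scoped ENNReal

noncomputable section

/-! ### Point processes -/

/-- A counting measure: every measurable set has measure in `{0, 1, 2, …, ∞}`. -/
def IsCountingMeasure {S : Type*} [MeasurableSpace S] (μ : Measure S) : Prop :=
  ∀ A : Set S, MeasurableSet A → ∃ m : ℕ∞, μ A = (m : ℝ≥0∞)

/-- A point process on `S`: a random counting measure on `S` (the space of measures carries the
σ-algebra generated by the evaluations `μ ↦ μ A`, `A` measurable). -/
structure IsPointProcess {Ω S : Type*} [MeasurableSpace Ω] [MeasurableSpace S]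
    (Z : Ω → Measure S) : Prop where
  measurable : Measurable Z
  counting : ∀ ω, IsCountingMeasure (Z ω)

/-- A point process is `k`-homogeneous if it almost surely has exactly `k` points, counted with
multiplicity. -/
def IsHomogeneous {Ω S : Type*} [MeasurableSpace Ω] [MeasurableSpace S]
    (P : Measure Ω) (Z : Ω → Measure S) (k : ℕ) : Prop :=
  ∀ᵐ ω ∂P, Z ω Set.univ = (k : ℝ≥0∞)

/-- The total variation distance `|μ - ν|(S)` of two finite measures. -/
def tvDist {S : Type*} [MeasurableSpace S] (μ ν : Measure S)
    [IsFiniteMeasure μ] [IsFiniteMeasure ν] : ℝ :=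
  (μ.toSignedMeasure - ν.toSignedMeasure).totalVariation.real Set.univ

/-- `f` is Lipschitz-1, for the total variation distance, on the counting measures of total
mass `k`. (Finiteness of the two measures is automatic from their mass.) -/
def IsLipschitzOneTV {S : Type*} [MeasurableSpace S] (k : ℕ) (f : Measure S → ℝ) : Prop :=
  ∀ (μ ν : Measure S) [IsFiniteMeasure μ] [IsFiniteMeasure ν],
    IsCountingMeasure μ → IsCountingMeasure ν →
    μ Set.univ = (k : ℝ≥0∞) → ν Set.univ = (k : ℝ≥0∞) →
    |f μ - f ν| ≤ tvDist μ ν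

/-- The law `ν` of a point process stochastically covers the law `ρ` of another one: there is a
coupling supported on pairs `(μ, μ')` with `μ = μ'` or `μ = μ' + δ_x` for some point `x`. -/
def StochCovers {S : Type*} [MeasurableSpace S] (ν ρ : Measure (Measure S)) : Prop :=
  ∃ π : Measure (Measure S × Measure S),
    π.map Prod.fst = ν ∧ π.map Prod.snd = ρ ∧
    ∀ᵐ p ∂π, p.1 = p.2 ∨ ∃ x : S, p.1 = p.2 + Measure.dirac x

open Classical in
/-- The law of a uniformly random ordering of the `k` points of the counting measure `μ`: if
`x₁, …, x_k` lists the points of `μ` with multiplicity, it is the average of the point masses at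
the `k!` rearrangements of `(x₁, …, x_k)`, which does not depend on the listing. -/
def uniformOrdering {S : Type*} [MeasurableSpace S] (k : ℕ) (μ : Measure S) :
    Measure (Fin k → S) :=
  if h : ∃ x : Fin k → S, ∑ i, Measure.dirac (x i) = μ then
    (k.factorial : ℝ≥0∞)⁻¹ •
      ∑ σ : Equiv.Perm (Fin k), Measure.dirac (fun i => h.choose (σ i))
  else 0

/-- The exchangeable law on `S^k` of a `k`-homogeneous point process `Z`: the law of the sequence
of the points of `Z`, put in uniformly random order. -/
def orderedLaw {Ω S : Type*} [MeasurableSpace Ω] [MeasurableSpace S]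
    (P : Measure Ω) (Z : Ω → Measure S) (k : ℕ) : Measure (Fin k → S) :=
  P.bind (fun ω => uniformOrdering k (Z ω))

theorem uniformOrdering_univ_le {S : Type*} [MeasurableSpace S] (k : ℕ) (μ : Measure S) :
    uniformOrdering k μ Set.univ ≤ 1 := by
  unfold uniformOrdering
  split_ifs with h
  · simp only [Measure.smul_apply, Measure.finsetSum_apply, measure_univ, smul_eq_mul,
      Finset.sum_const, Finset.card_univ, Fintype.card_perm, Fintype.card_fin, nsmul_eq_mul,
      mul_one]
    exact ENNReal.inv_mul_le_one _
  · simp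

instance {Ω S : Type*} [MeasurableSpace Ω] [MeasurableSpace S]
    (P : Measure Ω) [IsFiniteMeasure P] (Z : Ω → Measure S) (k : ℕ) :
    IsFiniteMeasure (orderedLaw P Z k) := by
  refine ⟨?_⟩
  by_cases hm : AEMeasurable (fun ω => uniformOrdering k (Z ω)) P
  · unfold orderedLaw
    rw [Measure.bind_apply MeasurableSet.univ hm]
    calc ∫⁻ ω, uniformOrdering k (Z ω) Set.univ ∂P
        ≤ ∫⁻ _, 1 ∂P := lintegral_mono fun ω => uniformOrdering_univ_le k (Z ω)
      _ = P Set.univ := by simp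
      _ < ⊤ := measure_lt_top P _
  · simp [orderedLaw, Measure.bind, Measure.map_of_not_aemeasurable hm]

/-- The σ-algebra on `S^k` generated by the first `j` coordinates. -/
abbrev firstCoords (S : Type*) [MeasurableSpace S] (k j : ℕ) : MeasurableSpace (Fin k → S) :=
  MeasurableSpace.comap (fun (x : Fin k → S) (i : {i : Fin k // (i : ℕ) < j}) => x i) inferInstance

/-- The law of the point process `Z_{x₁, …, x_j}`: with `(X₁, …, X_k)` the points of `Z` in
uniformly random order, it is the conditional law of `δ_{X_{j+1}} + ⋯ + δ_{X_k}` given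
`X₁ = x₁, …, X_j = x_j`. It depends on `x` only through its first `j` coordinates.
(Coordinates are numbered from `0` in the code.) -/
def residualLaw {Ω S : Type*} [MeasurableSpace Ω] [MeasurableSpace S] [StandardBorelSpace S]
    (P : Measure Ω) [IsFiniteMeasure P] (Z : Ω → Measure S) (k j : ℕ) (x : Fin k → S) :
    Measure (Measure S) :=
  (condExpKernel (orderedLaw P Z k) (firstCoords S k j) x).map
    (fun y : Fin k → S => ∑ i : {i : Fin k // j ≤ (i : ℕ)}, Measure.dirac (y i))

/-- The stochastic covering property of a `k`-homogeneous point process `Z`: for `0 ≤ j < k`,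
`Z_{x₁, …, x_j}` stochastically covers `Z_{x₁, …, x_{j+1}}`. Conditional laws being defined up to
null sets, this is asked for almost every choice of the points. -/
def HasSCP {Ω S : Type*} [MeasurableSpace Ω] [MeasurableSpace S] [StandardBorelSpace S]
    (P : Measure Ω) [IsFiniteMeasure P] (Z : Ω → Measure S) (k : ℕ) : Prop :=
  ∀ j < k, ∀ᵐ x ∂(orderedLaw P Z k),
    StochCovers (residualLaw P Z k j x) (residualLaw P Z k (j + 1) x)

/-! ### Measures on the Boolean lattice -/

/-- A measure on `{0,1}^n` is `k`-homogeneous if it is supported on the strings with exactly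
`k` ones. -/
def IsHomogeneousCube {n : ℕ} (ν : Measure (Fin n → Bool)) (k : ℕ) : Prop :=
  ∀ᵐ ω ∂ν, (Finset.univ.filter fun i => ω i = true).card = k

/-- `ν` stochastically covers `ρ` on the Boolean lattice `{0,1}^ι`: there is a coupling supported
on pairs `(x, y)` with `x = y` or `x` covering `y` in the coordinatewise order. -/
def StochCoversCube {ι : Type*} (ν ρ : Measure (ι → Bool)) : Prop :=
  ∃ π : Measure ((ι → Bool) × (ι → Bool)),
    π.map Prod.fst = ν ∧ π.map Prod.snd = ρ ∧ ∀ᵐ p ∂π, p.1 = p.2 ∨ p.2 ⋖ p.1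

/-- The conditional law under `ν` of the coordinates outside `T`, given that the coordinates
in `T` are equal to `x`. -/
def condCube {n : ℕ} (ν : Measure (Fin n → Bool)) (T : Set (Fin n)) (x : T → Bool) :
    Measure (↥(Tᶜ) → Bool) :=
  (ν[|T.domRestrict ⁻¹' {x}]).map (Tᶜ).domRestrict

/-- The stochastic covering property of a probability measure on `{0,1}^n`: if `x` covers `y` in
`{0,1}^T`, then the conditional law given `y` covers the conditional law given `x` (whenever both
are defined, that is, the conditioning events have positive probability). -/
def HasSCPCube {n : ℕ} (ν : Measure (Fin n → Bool)) : Prop :=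
  ∀ (T : Set (Fin n)) (x y : T → Bool), y ⋖ x →
    ν (T.domRestrict ⁻¹' {x}) ≠ 0 → ν (T.domRestrict ⁻¹' {y}) ≠ 0 →
    StochCoversCube (condCube ν T y) (condCube ν T x)

end

/-! ### Counting measures -/

namespace IsCountingMeasure

variable {S : Type*} [MeasurableSpace S]

/-! Point processes: list the points of `Z` in uniformly random order, `X₁, …, X_k`, and follow the
Doob martingale of `f(Z)` as they are revealed one by one. Given the first `j` points, `Z` is their
sum plus the residual process. The SCP couples the residuals after `j` and `j + 1` points; their
masses differ by one, so the larger is the smaller plus a point mass `δ_z`. The two completed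
configurations then differ only in that `z` is replaced by `X_{j+1}`, a change of at most `2` in
total variation. The martingale has `k` increments bounded by `2`, and Azuma–Hoeffding gives
`exp(-a² / (2 · 4k))`. The increment bound is `abs_integral_condExpKernel_sub_le`. Before it comes
the measure theory of random orderings: finite counting measures are sums of point masses, and the
random ordering depends measurably on the measure.

Boolean lattice: the SCP here compares conditioning a coordinate to be `0` with conditioning it to
be `1`. The ones of the string are still revealed in random order, but the martingale is replaced by
an induction on moment generating functions. Given ones on `T`, the law is a mixture of the laws
given ones on `insert i T`. By the SCP their means are within `2` of the current mean, so
Hoeffding's lemma costs a factor `exp(2t²)` per revealed one, and a Chernoff bound concludes. -/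

theorem add {μ ν : Measure S} (hμ : IsCountingMeasure μ) (hν : IsCountingMeasure ν) :
    IsCountingMeasure (μ + ν) := by
  intro A hA
  obtain ⟨m, hm⟩ := hμ A hA
  obtain ⟨n, hn⟩ := hν A hA
  exact ⟨m + n, by simp [hm, hn]⟩

theorem zero : IsCountingMeasure (0 : Measure S) := fun _ _ => ⟨0, by simp⟩

theorem dirac (x : S) : IsCountingMeasure (Measure.dirac x) := by
  intro A hA
  by_cases hx : x ∈ A
  · exact ⟨1, by simp [Measure.dirac_apply' _ hA, hx]⟩
  · exact ⟨0, by simp [Measure.dirac_apply' _ hA, hx]⟩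

theorem sum {ι : Type*} (s : Finset ι) {μ : ι → Measure S}
    (h : ∀ i ∈ s, IsCountingMeasure (μ i)) : IsCountingMeasure (∑ i ∈ s, μ i) :=
  Finset.sum_induction _ _ (fun _ _ => add) zero h

theorem exists_nat {μ : Measure S} [IsFiniteMeasure μ]
    (h : IsCountingMeasure μ) {A : Set S} (hA : MeasurableSet A) : ∃ n : ℕ, μ A = n := by
  obtain ⟨m, hm⟩ := h A hA
  have : m ≠ ⊤ := by
    rintro rfl
    exact measure_ne_top μ A (by simp at hm)
  lift m to ℕ using this
  exact ⟨m, by simpa using hm⟩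

/-- A nonzero finite counting measure on a standard Borel space has an atom. -/
theorem exists_dirac_le [StandardBorelSpace S] {μ : Measure S} [IsFiniteMeasure μ]
    (h : IsCountingMeasure μ) (h0 : μ ≠ 0) : ∃ x, Measure.dirac x ≤ μ := by
  classical
  -- On a set `A` of least nonzero measure `n`, every measurable subset has measure `0` or `n`. The
  -- normalised restriction is thus a zero-one measure, which on a standard Borel space is a point
  -- mass.
  have hex : ∃ n : ℕ, n ≠ 0 ∧ ∃ A, MeasurableSet A ∧ μ A = n := by
    obtain ⟨n, hn⟩ := h.exists_nat MeasurableSet.univ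
    refine ⟨n, ?_, _, MeasurableSet.univ, hn⟩
    rintro rfl
    exact h0 (Measure.measure_univ_eq_zero.1 (by simpa using hn))
  obtain ⟨hn0, A, hA, hAn⟩ := Nat.find_spec hex
  set n := Nat.find hex with hn
  have hn0' : (n : ℝ≥0∞) ≠ 0 := by exact_mod_cast hn0
  have hinv : (n : ℝ≥0∞)⁻¹ * n = 1 := ENNReal.inv_mul_cancel hn0' (ENNReal.natCast_ne_top n)
  let ρ : Measure S := (n : ℝ≥0∞)⁻¹ • μ.restrict A
  have : IsZeroOneMeasure ρ := by
    refine ⟨fun B hB => ?_⟩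
    obtain ⟨m, hm⟩ := h.exists_nat (hB.inter hA)
    have hval : ρ B = (n : ℝ≥0∞)⁻¹ * m := by
      simp [ρ, Measure.restrict_apply hB, hm]
    by_cases hm0 : m = 0
    · left; simp [hval, hm0]
    · right
      have h1 : n ≤ m := Nat.find_min' hex ⟨hm0, _, hB.inter hA, hm⟩
      have h2 : (m : ℝ≥0∞) ≤ n := hm ▸ hAn ▸ measure_mono Set.inter_subset_right
      have : m = n := le_antisymm (by exact_mod_cast h2) h1
      rw [hval, this, hinv]
  have hne : NeZero ρ := by
    refine ⟨fun h => ?_⟩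
    have : ρ A = 1 := by simp [ρ, hAn, hinv]
    simp [h] at this
  obtain ⟨x, hx⟩ := IsZeroOneMeasure.exists_eq_dirac (μ := ρ)
  refine ⟨x, hx ▸ Measure.le_iff.2 fun B hB => ?_⟩
  calc ρ B ≤ 1 * μ.restrict A B := by
        simp only [ρ, Measure.smul_apply, smul_eq_mul]
        gcongr
        exact ENNReal.inv_le_one.2 (by exact_mod_cast Nat.one_le_iff_ne_zero.2 hn0)
    _ ≤ μ B := by rw [one_mul]; exact Measure.restrict_apply_le _ _

/-- On a standard Borel space, a counting measure of total mass `k` is the sum of `k` point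
masses. -/
theorem exists_sum_dirac [StandardBorelSpace S] (k : ℕ) {μ : Measure S}
    (h : IsCountingMeasure μ) (hk : μ Set.univ = k) :
    ∃ x : Fin k → S, ∑ i, Measure.dirac (x i) = μ := by
  induction k generalizing μ with
  | zero => exact ⟨Fin.elim0, by simpa using (Measure.measure_univ_eq_zero.1 (by simpa using hk)).symm⟩
  | succ k ih =>
    have : IsFiniteMeasure μ := ⟨by simp [hk]⟩
    have h0 : μ ≠ 0 := by
      rintro rfl
      simp at hk
      norm_cast at hk
    obtain ⟨x, hx⟩ := h.exists_dirac_le h0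
    have hc : IsCountingMeasure (μ - Measure.dirac x) := by
      intro A hA
      obtain ⟨m, hm⟩ := h A hA
      obtain ⟨n, hn⟩ := IsCountingMeasure.dirac x A hA
      exact ⟨m - n, by rw [Measure.sub_apply hA hx, hm, hn, ENat.toENNReal_sub]⟩
    obtain ⟨y, hy⟩ := ih hc (by
      rw [Measure.sub_apply MeasurableSet.univ hx, hk]; simp)
    refine ⟨Fin.cons x y, ?_⟩
    rw [Fin.sum_univ_succ]
    simp only [Fin.cons_zero, Fin.cons_succ, hy]
    rw [add_comm, Measure.sub_add_cancel_of_le hx]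

end IsCountingMeasure

section

variable {S : Type*} [MeasurableSpace S]

theorem isCountingMeasure_sum_dirac {ι : Type*} (s : Finset ι) (x : ι → S) :
    IsCountingMeasure (∑ i ∈ s, Measure.dirac (x i)) :=
  .sum s fun i _ => .dirac (x i)

theorem sum_dirac_univ {ι : Type*} (s : Finset ι) (x : ι → S) :
    (∑ i ∈ s, Measure.dirac (x i)) Set.univ = s.card := by
  simp

/-- The counting measures of total mass `k` form a measurable set. -/
theorem measurableSet_isCountingMeasure [MeasurableSpace.CountablyGenerated S] (k : ℕ) :
    MeasurableSet {μ : Measure S | IsCountingMeasure μ ∧ μ Set.univ = (k : ℝ≥0∞)} := by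
  -- Integrality need only be tested on a countable generating algebra: its members approximate any
  -- measurable `B` in `μ`-measure, so `μ B` is a limit of integers, hence an integer.
  let 𝒜 := generateSetAlgebra (MeasurableSpace.countableGeneratingSet S)
  have hcount : 𝒜.Countable :=
    countable_generateSetAlgebra (MeasurableSpace.countable_countableGeneratingSet)
  have hgen : ‹MeasurableSpace S› = MeasurableSpace.generateFrom 𝒜 := by
    rw [generateFrom_generateSetAlgebra_eq, MeasurableSpace.generateFrom_countableGeneratingSet]
  have hmeas : ∀ A ∈ 𝒜, MeasurableSet A := fun A hA => by
    rw [hgen]; exact MeasurableSpace.measurableSet_generateFrom hA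
  have heq : {μ : Measure S | IsCountingMeasure μ ∧ μ Set.univ = (k : ℝ≥0∞)} =
      (⋂ A ∈ 𝒜, (fun μ : Measure S => μ A) ⁻¹' Set.range (fun n : ℕ => (n : ℝ≥0∞))) ∩
        (fun μ : Measure S => μ Set.univ) ⁻¹' {(k : ℝ≥0∞)} := by
    ext μ
    simp only [Set.mem_inter_iff, Set.mem_iInter, Set.mem_preimage, Set.mem_range,
      Set.mem_singleton_iff]
    refine and_congr_left fun hk => ?_
    have : IsFiniteMeasure μ := ⟨by simp [hk]⟩
    constructor
    · intro h A hA
      obtain ⟨n, hn⟩ := h.exists_nat (hmeas A hA)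
      exact ⟨n, hn.symm⟩
    · intro h B hB
      have hd := Measure.MeasureDense.of_generateFrom_isSetAlgebra_finite (μ := μ)
        isSetAlgebra_generateSetAlgebra hgen
      have hint : ∀ ε > 0, ∃ n : ℕ, |μ.real B - n| < ε := by
        intro ε hε
        obtain ⟨A, hA, hAB⟩ := hd.approx B hB (measure_ne_top _ _) ε hε
        obtain ⟨n, hn⟩ := h A hA
        refine ⟨n, ?_⟩
        have hn' : μ.real A = n := by simp [Measure.real, ← hn]
        rw [← hn']
        refine (abs_measureReal_sub_le_measureReal_symmDiff hB.nullMeasurableSet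
          (hmeas A hA).nullMeasurableSet).trans_lt ?_
        exact ENNReal.toReal_lt_of_lt_ofReal hAB
      have hcl : μ.real B ∈ Set.range (fun n : ℕ => (n : ℝ)) := by
        have : IsClosed (Set.range (fun n : ℕ => (n : ℝ))) :=
          Nat.isClosedEmbedding_coe_real.isClosed_range
        rw [← this.closure_eq, Metric.mem_closure_iff]
        intro ε hε
        obtain ⟨n, hn⟩ := hint ε hε
        exact ⟨n, ⟨n, rfl⟩, by rwa [Real.dist_eq]⟩
      obtain ⟨n, hn⟩ := hcl
      refine ⟨n, ?_⟩
      rw [← ofReal_measureReal (measure_ne_top μ B), ← hn]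
      simp
  rw [heq]
  refine (MeasurableSet.biInter hcount fun A hA => ?_).inter ?_
  · exact (Measure.measurable_coe (hmeas A hA)) (Set.countable_range _).measurableSet
  · exact (Measure.measurable_coe MeasurableSet.univ) (measurableSet_singleton _)

/-! ### Total variation -/

theorem MeasureTheory.SignedMeasure.totalVariation_toSignedMeasure_sub_univ_le (μ ν : Measure S)
    [IsFiniteMeasure μ] [IsFiniteMeasure ν] :
    (μ.toSignedMeasure - ν.toSignedMeasure).totalVariation.real Set.univ ≤
      μ.real Set.univ + ν.real Set.univ := by
  set s := μ.toSignedMeasure - ν.toSignedMeasure with hs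
  obtain ⟨i, hi, h1, h2, hp, hn⟩ := s.toJordanDecomposition_spec
  have h3 : s.totalVariation.real Set.univ = s i - s iᶜ := by
    rw [SignedMeasure.totalVariation, measureReal_add_apply, hp, hn,
      SignedMeasure.toMeasureOfZeroLE_real_apply _ h1 hi MeasurableSet.univ,
      SignedMeasure.toMeasureOfLEZero_real_apply _ h2 hi.compl MeasurableSet.univ]
    simp [sub_eq_add_neg]
  rw [h3, hs, Measure.toSignedMeasure_sub_apply hi, Measure.toSignedMeasure_sub_apply hi.compl,
    ← measureReal_add_measureReal_compl (μ := μ) hi, ← measureReal_add_measureReal_compl (μ := ν) hi]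
  linarith [measureReal_nonneg (μ := μ) (s := iᶜ), measureReal_nonneg (μ := ν) (s := iᶜ),
    measureReal_nonneg (μ := μ) (s := i), measureReal_nonneg (μ := ν) (s := i)]

theorem tvDist_le (μ ν : Measure S) [IsFiniteMeasure μ] [IsFiniteMeasure ν] :
    tvDist μ ν ≤ μ.real Set.univ + ν.real Set.univ :=
  SignedMeasure.totalVariation_toSignedMeasure_sub_univ_le μ ν

/-- The common part cancels in the signed difference. This is why moving one point costs `2` and not
`2k`. -/
theorem tvDist_add_left (ρ μ ν : Measure S) [IsFiniteMeasure ρ] [IsFiniteMeasure μ]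
    [IsFiniteMeasure ν] : tvDist (ρ + μ) (ρ + ν) = tvDist μ ν := by
  simp [tvDist, Measure.toSignedMeasure_add]

end

/-! ### Uniform orderings of a counting measure -/

/-- Two families of the same finite length in which every value occurs equally often are
rearrangements of each other. -/
theorem exists_perm_comp_eq_of_card_fiber_eq {ι α : Type*} [Fintype ι] (f g : ι → α)
    (h : ∀ a, Nat.card {i // f i = a} = Nat.card {i // g i = a}) :
    ∃ τ : Equiv.Perm ι, ∀ i, f (τ i) = g i := by
  classical
  let e : ∀ a, {i // g i = a} ≃ {i // f i = a} := fun a =>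
    (Finite.card_eq.1 (h a).symm).some
  exact ⟨Equiv.ofFiberEquiv e, fun i => Equiv.ofFiberEquiv_map e i⟩

section

variable {S : Type*} [MeasurableSpace S] {k : ℕ}

theorem sum_dirac_apply {ι : Type*} [Fintype ι] (x : ι → S) {B : Set S} (hB : MeasurableSet B) :
    (∑ i, Measure.dirac (x i)) B = (Nat.card {i // x i ∈ B} : ℝ≥0∞) := by
  classical
  rw [Measure.finsetSum_apply]
  simp_rw [Measure.dirac_apply' _ hB]
  simp [Set.indicator_apply, Finset.sum_boole, Nat.card_eq_fintype_card, Fintype.card_subtype]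

theorem sum_dirac_comp_perm (x : Fin k → S) (σ : Equiv.Perm (Fin k)) :
    ∑ i, Measure.dirac (x (σ i)) = ∑ i, Measure.dirac (x i) :=
  Equiv.sum_comp σ fun i => Measure.dirac (x i)

theorem exists_sum_dirac_iff [StandardBorelSpace S] {μ : Measure S} :
    (∃ x : Fin k → S, ∑ i, Measure.dirac (x i) = μ) ↔
      IsCountingMeasure μ ∧ μ Set.univ = (k : ℝ≥0∞) := by
  constructor
  · rintro ⟨x, rfl⟩
    exact ⟨isCountingMeasure_sum_dirac _ _, by simp⟩
  · exact fun h => h.1.exists_sum_dirac k h.2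

instance (μ : Measure S) : IsFiniteMeasure (uniformOrdering k μ) :=
  ⟨(uniformOrdering_univ_le k μ).trans_lt ENNReal.one_lt_top⟩

theorem uniformOrdering_apply_univ {μ : Measure S}
    (h : ∃ x : Fin k → S, ∑ i, Measure.dirac (x i) = μ) :
    uniformOrdering k μ Set.univ = 1 := by
  rw [uniformOrdering, dif_pos h]
  simp only [Measure.smul_apply, Measure.finsetSum_apply, measure_univ, smul_eq_mul,
    Finset.sum_const, Finset.card_univ, Fintype.card_perm, Fintype.card_fin, nsmul_eq_mul, mul_one]
  exact ENNReal.inv_mul_cancel (by exact_mod_cast k.factorial_ne_zero) (ENNReal.natCast_ne_top _)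

/-- Whether a rearrangement lies in the box depends only on which sides `A i` contain each entry. If
these types occur equally often in `x` and `y`, a permutation `τ` matches them, and `σ ↦ τσ`
reindexes the sum. -/
theorem sum_perm_dirac_apply_eq {A : Fin k → Set S} (hA : ∀ i, MeasurableSet (A i))
    (x y : Fin k → S) (h : ∀ b : Set (Fin k), Nat.card {j // {i | x j ∈ A i} = b} =
      Nat.card {j // {i | y j ∈ A i} = b}) :
    ∑ σ : Equiv.Perm (Fin k), Measure.dirac (fun i => x (σ i)) (Set.univ.pi A) =
      ∑ σ : Equiv.Perm (Fin k), Measure.dirac (fun i => y (σ i)) (Set.univ.pi A) := by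
  classical
  obtain ⟨τ, hτ⟩ := exists_perm_comp_eq_of_card_fiber_eq _ _ h
  have hpi : MeasurableSet (Set.univ.pi A) := MeasurableSet.univ_pi hA
  rw [← Equiv.sum_comp (Equiv.mulLeft τ)]
  refine Finset.sum_congr rfl fun σ _ => ?_
  rw [Measure.dirac_apply' _ hpi, Measure.dirac_apply' _ hpi]
  have : (fun i => x ((Equiv.mulLeft τ σ) i)) ∈ Set.univ.pi A ↔
      (fun i => y (σ i)) ∈ Set.univ.pi A := by
    simp only [Set.mem_univ_pi]
    refine forall_congr' fun i => ?_
    exact Set.ext_iff.1 (hτ (σ i)) i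
  rw [Set.indicator_apply, Set.indicator_apply, if_congr this rfl rfl]
  rfl

/-- The listing in the definition is an arbitrary choice, so measurability is obtained otherwise:
the mass of a box depends on `μ` only through the numbers of points of each type, a measurable map
into a countable space. -/
theorem measurable_uniformOrdering [StandardBorelSpace S] :
    Measurable (uniformOrdering k : Measure S → Measure (Fin k → S)) := by
  classical
  set G : Set (Measure S) := {μ | IsCountingMeasure μ ∧ μ Set.univ = (k : ℝ≥0∞)} with hG
  have hGm : MeasurableSet G := measurableSet_isCountingMeasure k
  have hzero : ∀ μ ∉ G, uniformOrdering k μ = 0 := fun μ hμ => by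
    rw [uniformOrdering, dif_neg]
    rwa [exists_sum_dirac_iff]
  refine Measurable.measure_of_isPiSystem generateFrom_pi.symm isPiSystem_pi ?_ ?_
  · rintro _ ⟨A, hA, rfl⟩
    replace hA : ∀ i, MeasurableSet (A i) := fun i => hA i (Set.mem_univ i)
    let t : S → Set (Fin k) := fun s => {i | s ∈ A i}
    have ht : ∀ b, MeasurableSet (t ⁻¹' {b}) := by
      intro b
      have : t ⁻¹' {b} = ⋂ i, if i ∈ b then A i else (A i)ᶜ := by
        ext s
        simp only [Set.mem_preimage, Set.mem_singleton_iff, Set.mem_iInter, Set.ext_iff, t,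
          Set.mem_ofPred_eq]
        refine forall_congr' fun i => ?_
        by_cases hi : i ∈ b <;> simp [hi]
      rw [this]
      refine MeasurableSet.iInter fun i => ?_
      split_ifs
      exacts [hA i, (hA i).compl]
    -- On `G` these measures are already integers; the floor only makes the target countable off `G`
    -- too.
    let c : Measure S → (Set (Fin k) → ℕ) := fun μ b => ⌊(μ (t ⁻¹' {b})).toReal⌋₊
    have hc : Measurable c := measurable_pi_iff.2 fun b =>
      Nat.measurable_floor.comp (Measure.measurable_coe (ht b)).ennreal_toReal
    have hcx : ∀ (x : Fin k → S) b, c (∑ i, Measure.dirac (x i)) b =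
        Nat.card {j // {i | x j ∈ A i} = b} := by
      intro x b
      simp only [c]
      rw [sum_dirac_apply x (ht b)]
      simp [t]
    have hfac : ∀ μ ∈ G, ∀ ν ∈ G, c μ = c ν →
        uniformOrdering k μ (Set.univ.pi A) = uniformOrdering k ν (Set.univ.pi A) := by
      intro μ hμ ν hν hμν
      have hμ' := exists_sum_dirac_iff.2 hμ
      have hν' := exists_sum_dirac_iff.2 hν
      rw [uniformOrdering, dif_pos hμ', uniformOrdering, dif_pos hν']
      simp only [Measure.smul_apply, Measure.finsetSum_apply]
      congr 1
      refine sum_perm_dirac_apply_eq hA _ _ fun b => ?_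
      rw [← hcx, ← hcx, hμ'.choose_spec, hν'.choose_spec, hμν]
    let H : (Set (Fin k) → ℕ) → ℝ≥0∞ := fun v =>
      if h : ∃ μ ∈ G, c μ = v then uniformOrdering k h.choose (Set.univ.pi A) else 0
    have hFH : (fun μ => uniformOrdering k μ (Set.univ.pi A)) = G.indicator (H ∘ c) := by
      ext μ
      by_cases hμ : μ ∈ G
      · have hex : ∃ ν ∈ G, c ν = c μ := ⟨μ, hμ, rfl⟩
        simp only [Set.indicator_of_mem hμ, Function.comp_apply, H, dif_pos hex]
        exact hfac _ hμ _ hex.choose_spec.1 hex.choose_spec.2.symm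
      · simp [Set.indicator_of_notMem hμ, hzero μ hμ]
    rw [hFH]
    exact ((measurable_of_countable H).comp hc).indicator hGm
  · have : (fun μ : Measure S => uniformOrdering k μ Set.univ) = G.indicator 1 := by
      ext μ
      by_cases hμ : μ ∈ G
      · simp [Set.indicator_of_mem hμ, uniformOrdering_apply_univ (exists_sum_dirac_iff.2 hμ)]
      · simp [Set.indicator_of_notMem hμ, hzero μ hμ]
    rw [this]
    exact measurable_one.indicator hGm

theorem measurable_sum_dirac {ι : Type*} (s : Finset ι) :
    Measurable fun x : ι → S => ∑ i ∈ s, Measure.dirac (x i) := by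
  refine Measure.measurable_of_measurable_coe _ fun B hB => ?_
  simp only [Measure.finsetSum_apply]
  exact Finset.measurable_fun_sum _ fun i _ =>
    (Measure.measurable_coe hB).comp (Measure.measurable_dirac.comp (measurable_pi_apply i))

theorem map_uniformOrdering {μ : Measure S}
    (h : ∃ x : Fin k → S, ∑ i, Measure.dirac (x i) = μ) :
    (uniformOrdering k μ).map (fun y => ∑ i, Measure.dirac (y i)) = Measure.dirac μ := by
  classical
  have hm := measurable_sum_dirac (S := S) (Finset.univ : Finset (Fin k))
  ext B hB
  rw [Measure.map_apply hm hB, uniformOrdering, dif_pos h]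
  simp only [Measure.smul_apply, Measure.finsetSum_apply, smul_eq_mul]
  have : ∀ σ : Equiv.Perm (Fin k), Measure.dirac (fun i => h.choose (σ i))
      ((fun y : Fin k → S => ∑ i, Measure.dirac (y i)) ⁻¹' B) = Measure.dirac μ B := by
    intro σ
    rw [Measure.dirac_apply' _ (hm hB), Measure.dirac_apply' _ hB]
    have h1 : ∑ i, Measure.dirac (h.choose (σ i)) = μ :=
      (sum_dirac_comp_perm _ σ).trans h.choose_spec
    rw [Set.indicator_apply, Set.indicator_apply, Set.mem_preimage, h1]
    rfl
  simp only [this, Finset.sum_const, Finset.card_univ, Fintype.card_perm, Fintype.card_fin,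
    nsmul_eq_mul]
  rw [← mul_assoc, ENNReal.inv_mul_cancel (by exact_mod_cast k.factorial_ne_zero)
    (ENNReal.natCast_ne_top _), one_mul]

variable {Ω : Type*} [MeasurableSpace Ω]

/-- Forgetting the order of the points recovers the law of the point process. -/
theorem map_orderedLaw [StandardBorelSpace S] (P : Measure Ω) {Z : Ω → Measure S}
    (hZ : IsPointProcess Z) (hk : IsHomogeneous P Z k) :
    (orderedLaw P Z k).map (fun y => ∑ i, Measure.dirac (y i)) = P.map Z := by
  have hm := measurable_sum_dirac (S := S) (Finset.univ : Finset (Fin k))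
  have hu : AEMeasurable (fun ω => uniformOrdering k (Z ω)) P :=
    (measurable_uniformOrdering.comp hZ.measurable).aemeasurable
  ext B hB
  rw [Measure.map_apply hm hB, orderedLaw, Measure.bind_apply (hm hB) hu,
    ← lintegral_indicator_one hB, lintegral_map (measurable_one.indicator hB) hZ.measurable]
  refine lintegral_congr_ae ?_
  filter_upwards [hk] with ω hω
  rw [← Measure.map_apply hm hB,
    map_uniformOrdering (exists_sum_dirac_iff.2 ⟨hZ.counting ω, hω⟩), Measure.dirac_apply' _ hB]

theorem isProbabilityMeasure_orderedLaw [StandardBorelSpace S] (P : Measure Ω)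
    [IsProbabilityMeasure P] {Z : Ω → Measure S} (hZ : IsPointProcess Z)
    (hk : IsHomogeneous P Z k) : IsProbabilityMeasure (orderedLaw P Z k) := by
  have hm := measurable_sum_dirac (S := S) (Finset.univ : Finset (Fin k))
  refine ⟨?_⟩
  rw [← Set.preimage_univ (f := fun y : Fin k → S => ∑ i, Measure.dirac (y i)),
    ← Measure.map_apply hm MeasurableSet.univ, map_orderedLaw P hZ hk,
    Measure.map_apply hZ.measurable MeasurableSet.univ, Set.preimage_univ, measure_univ]

end

/-! ### Bounded martingale differences -/

section

variable {Ω : Type*} {m mΩ : MeasurableSpace Ω} [StandardBorelSpace Ω] {μ : Measure Ω}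

/-- **Hoeffding's lemma**, conditional version. -/
theorem hasCondSubgaussianMGF_of_mem_Icc [IsFiniteMeasure μ] (hm : m ≤ mΩ) {X : Ω → ℝ}
    (hX : StronglyMeasurable X) {a b : ℝ} (hb : ∀ᵐ ω ∂μ, X ω ∈ Set.Icc a b)
    (hc : μ[X | m] =ᵐ[μ] 0) :
    HasCondSubgaussianMGF m hm X ((‖b - a‖₊ / 2) ^ 2) μ := by
  have hint : Integrable X μ := Integrable.of_mem_Icc a b hX.aestronglyMeasurable.aemeasurable hb
  refine ⟨fun t => ?_, ?_⟩
  · rw [condExpKernel_comp_trim hm]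
    exact integrable_exp_mul_of_mem_Icc hX.aestronglyMeasurable.aemeasurable hb
  · have h1 : ∀ᵐ ω ∂μ.trim hm, ∀ᵐ y ∂condExpKernel μ m ω, X y ∈ Set.Icc a b := by
      refine Measure.ae_ae_of_ae_comp ?_
      rwa [condExpKernel_comp_trim hm]
    have h2 : ∀ᵐ ω ∂μ.trim hm, ∫ y, X y ∂condExpKernel μ m ω = 0 := by
      have h3 := condExp_ae_eq_trim_integral_condExpKernel hm hint
      have h4 : μ[X | m] =ᵐ[μ.trim hm] (0 : Ω → ℝ) :=
        stronglyMeasurable_condExp.ae_eq_trim_of_stronglyMeasurable hm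
          stronglyMeasurable_zero hc
      filter_upwards [h3, h4] with ω h5 h6
      rw [← h5, h6, Pi.zero_apply]
    filter_upwards [h1, h2] with ω h5 h6 t
    exact (hasSubgaussianMGF_of_mem_Icc_of_integral_eq_zero
      hX.aestronglyMeasurable.aemeasurable h5 h6).mgf_le t

/-- **Azuma–Hoeffding inequality** for the Doob martingale of an integrable function along a
filtration that starts trivial and reveals the function after `k` steps. -/
theorem measureReal_sub_integral_ge_le_of_condExp_diff_le [IsProbabilityMeasure μ]
    (ℱ : Filtration ℕ mΩ) {g : Ω → ℝ} (hg : Integrable g μ) {k : ℕ}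
    (h0 : ℱ 0 = ⊥) (hgk : StronglyMeasurable[ℱ k] g) {C : ℝ} (hC : 0 ≤ C)
    (hdiff : ∀ j < k, ∀ᵐ ω ∂μ, |(μ[g | ℱ (j + 1)]) ω - (μ[g | ℱ j]) ω| ≤ C)
    {a : ℝ} (ha : 0 ≤ a) :
    μ.real {ω | a ≤ g ω - ∫ ω', g ω' ∂μ} ≤ Real.exp (-a ^ 2 / (2 * (k * C ^ 2))) := by
  -- The zeroth term of the sum must be sub-Gaussian unconditionally; it is padded by `0`, and the
  -- martingale increments are shifted by one. Hoeffding's constant for `[-C, C]` is `C²`.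
  let Y : ℕ → Ω → ℝ := fun n => Nat.casesOn n 0 fun j => μ[g | ℱ (j + 1)] - μ[g | ℱ j]
  let c : ℕ → NNReal := fun n => Nat.casesOn n 0 fun _ => (‖C - -C‖₊ / 2) ^ 2
  have hY : ∀ j, StronglyMeasurable[ℱ (j + 1)] (μ[g | ℱ (j + 1)] - μ[g | ℱ j]) := fun j =>
    stronglyMeasurable_condExp.sub (stronglyMeasurable_condExp.mono (ℱ.mono j.le_succ))
  have hadapt : StronglyAdapted ℱ Y := by
    intro n
    cases n with
    | zero => exact stronglyMeasurable_zero
    | succ j => exact hY j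
  have key := measure_sum_ge_le_of_hasCondSubgaussianMGF (μ := μ) (Y := Y) (cY := c) hadapt
    HasSubgaussianMGF.zero (k + 1) (fun j hj => by
      refine hasCondSubgaussianMGF_of_mem_Icc (ℱ.le j) ((hY j).mono (ℱ.le _)) ?_ ?_
      · filter_upwards [hdiff j hj] with ω hω
        exact abs_le.1 hω
      · have h1 := condExp_sub (μ := μ) (integrable_condExp (f := g) (m := ℱ (j + 1)))
          (integrable_condExp (f := g) (m := ℱ j)) (ℱ j)
        have h2 := condExp_condExp_of_le (μ := μ) (f := g) (ℱ.mono j.le_succ) (ℱ.le (j + 1))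
        have h3 : μ[μ[g | ℱ j] | ℱ j] = μ[g | ℱ j] :=
          condExp_of_stronglyMeasurable (ℱ.le j) stronglyMeasurable_condExp integrable_condExp
        filter_upwards [h1, h2] with ω h4 h5
        rw [h4, Pi.sub_apply, h5, h3, sub_self, Pi.zero_apply]) ha
  have hsum : ∀ ω, ∑ i ∈ Finset.range (k + 1), Y i ω = g ω - ∫ ω', g ω' ∂μ := by
    intro ω
    rw [Finset.sum_range_succ']
    have : ∀ j, Y (j + 1) ω = (μ[g | ℱ (j + 1)]) ω - (μ[g | ℱ j]) ω := fun j => rfl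
    simp only [this]
    rw [Finset.sum_range_sub (fun j => (μ[g | ℱ j]) ω), h0, condExp_bot,
      condExp_of_stronglyMeasurable (ℱ.le k) hgk hg]
    simp [Y]
  have hcsum : ((∑ i ∈ Finset.range (k + 1), c i : NNReal) : ℝ) = k * C ^ 2 := by
    rw [Finset.sum_range_succ']
    have h1 : ∀ j, c (j + 1) = (‖C - -C‖₊ / 2) ^ 2 := fun j => rfl
    have h2 : c 0 = 0 := rfl
    simp only [h1, h2, Finset.sum_const, Finset.card_range, nsmul_eq_mul, add_zero]
    push_cast
    rw [sub_neg_eq_add, Real.norm_of_nonneg (by linarith)]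
    ring
  simp only [hsum] at key
  refine key.trans (le_of_eq ?_)
  congr 2
  rw [← hcsum]

/-- The regular conditional law given a σ-algebra lives on the fibres of the maps that are
measurable for it. -/
theorem condExpKernel_ae_eq_of_measurable [IsFiniteMeasure μ] (hm : m ≤ mΩ) {T : Type*}
    [MeasurableSpace T] [StandardBorelSpace T] {φ : Ω → T} (hφ : Measurable[m] φ) :
    ∀ᵐ x ∂μ, ∀ᵐ y ∂condExpKernel μ m x, φ y = φ x := by
  let := upgradeStandardBorel T
  have h1 : MeasurableSet[m.prod mΩ] {p : Ω × Ω | φ p.2 = φ p.1} :=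
    @measurableSet_eq_fun (Ω × Ω) T (m.prod mΩ) _ _ _ _
      ((hφ.mono hm le_rfl).comp (@measurable_snd _ _ m mΩ)) (hφ.comp (@measurable_fst _ _ m mΩ))
  refine ae_of_ae_trim hm ?_
  have hdiag : @Measurable Ω (Ω × Ω) mΩ (m.prod mΩ) Function.diag :=
    (measurable_id'' hm).prodMk measurable_id
  -- Drawing `x`, then `y` from the conditional law at `x`, gives the image of `μ` on the diagonal,
  -- where the equality is trivial. It disintegrates because `φ` is `m`-measurable, so that the
  -- event is measurable with `m` on the first factor.
  have h2 : ∀ᵐ p ∂((μ.trim hm) ⊗ₘ condExpKernel μ m), φ p.2 = φ p.1 := by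
    rw [compProd_trim_condExpKernel hm]
    exact (@ae_map_iff Ω (Ω × Ω) mΩ (m.prod mΩ) _ _
      (@Measurable.aemeasurable _ _ _ (m.prod mΩ) _ _ hdiag) _ h1).2
      (ae_of_all _ fun x => rfl)
  exact Measure.ae_ae_of_ae_compProd h2

/-- Integrals of two functions that stay close along a coupling are close. -/
theorem abs_integral_sub_integral_le_of_coupling {A B : Type*} [MeasurableSpace A]
    [MeasurableSpace B] {ν : Measure A} {ρ : Measure B} [IsProbabilityMeasure ν]
    {π : Measure (A × B)} (h1 : π.map Prod.fst = ν) (h2 : π.map Prod.snd = ρ) {F : A → ℝ}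
    {G : B → ℝ} (hF : Integrable F ν) (hG : Integrable G ρ) {C : ℝ}
    (h : ∀ᵐ p ∂π, |F p.1 - G p.2| ≤ C) : |∫ a, F a ∂ν - ∫ b, G b ∂ρ| ≤ C := by
  subst h1 h2
  have : IsProbabilityMeasure π := Measure.isProbabilityMeasure_of_map Prod.fst
  rw [integral_map measurable_fst.aemeasurable hF.1, integral_map measurable_snd.aemeasurable hG.1,
    ← integral_sub (f := fun p : A × B => F p.1) (g := fun p : A × B => G p.2)
      (hF.comp_measurable measurable_fst) (hG.comp_measurable measurable_snd)]
  simpa using norm_integral_le_of_norm_le_const (μ := π) (f := fun p : A × B => F p.1 - G p.2) h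

end

/-! ### Concentration for point processes -/

section

variable {S : Type*} [MeasurableSpace S] {k : ℕ}

theorem isFiniteMeasure_of_univ_eq_natCast {μ : Measure S} (h : μ Set.univ = (k : ℝ≥0∞)) :
    IsFiniteMeasure μ :=
  ⟨by simp [h]⟩

namespace IsLipschitzOneTV

variable {f : Measure S → ℝ}

/-- Boundedness of `f` on configurations of `k` points, from which integrability follows. -/
theorem abs_sub_le (hf : IsLipschitzOneTV k f) {μ ν : Measure S} (hμ : IsCountingMeasure μ) (hν : IsCountingMeasure ν)
    (hμk : μ Set.univ = (k : ℝ≥0∞)) (hνk : ν Set.univ = (k : ℝ≥0∞)) :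
    |f μ - f ν| ≤ 2 * k := by
  have := isFiniteMeasure_of_univ_eq_natCast hμk
  have := isFiniteMeasure_of_univ_eq_natCast hνk
  refine (hf μ ν hμ hν hμk hνk).trans ((tvDist_le μ ν).trans (le_of_eq ?_))
  simp [Measure.real, hμk, hνk]
  ring

theorem abs_sub_add_dirac_le (hf : IsLipschitzOneTV k f) {ρ : Measure S} (hρ : IsCountingMeasure ρ) (x y : S)
    (hk : ρ Set.univ + 1 = (k : ℝ≥0∞)) :
    |f (ρ + Measure.dirac x) - f (ρ + Measure.dirac y)| ≤ 2 := by
  have : IsFiniteMeasure ρ := ⟨lt_of_le_of_lt le_self_add (hk ▸ ENNReal.natCast_lt_top k)⟩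
  refine (hf _ _ (hρ.add (.dirac x)) (hρ.add (.dirac y)) (by simpa using hk)
    (by simpa using hk)).trans ?_
  rw [tvDist_add_left]
  refine (tvDist_le _ _).trans (le_of_eq ?_)
  simp
  norm_num

end IsLipschitzOneTV

theorem sum_dirac_split (j : ℕ) (y : Fin k → S) :
    ∑ i, Measure.dirac (y i) = ∑ i : {i : Fin k // (i : ℕ) < j}, Measure.dirac (y i) +
      ∑ i : {i : Fin k // j ≤ (i : ℕ)}, Measure.dirac (y i) := by
  rw [← Fintype.sum_subtype_add_sum_subtype (fun i : Fin k => (i : ℕ) < j)]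
  congr 1
  exact Fintype.sum_equiv (Equiv.subtypeEquivRight fun i => not_lt) _ _ fun i => rfl

theorem sum_dirac_lt_succ {j : ℕ} (hj : j < k) (y : Fin k → S) :
    ∑ i : {i : Fin k // (i : ℕ) < j + 1}, Measure.dirac (y i) =
      ∑ i : {i : Fin k // (i : ℕ) < j}, Measure.dirac (y i) + Measure.dirac (y ⟨j, hj⟩) := by
  classical
  have h1 : ∀ n : ℕ, ∑ i : {i : Fin k // (i : ℕ) < n}, Measure.dirac (y i) =
      ∑ i ∈ Finset.univ.filter (fun i : Fin k => (i : ℕ) < n), Measure.dirac (y i) := fun n =>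
    (Finset.sum_subtype (Finset.univ.filter fun i : Fin k => (i : ℕ) < n) (by simp)
      fun i => Measure.dirac (y i)).symm
  rw [h1, h1]
  have h2 : Finset.univ.filter (fun i : Fin k => (i : ℕ) < j + 1) =
      insert ⟨j, hj⟩ (Finset.univ.filter (fun i : Fin k => (i : ℕ) < j)) := by
    ext i
    simp [Fin.ext_iff]
    omega
  rw [h2, Finset.sum_insert (by simp), add_comm]

theorem card_subtype_le (j : ℕ) : Fintype.card {i : Fin k // j ≤ (i : ℕ)} = k - j := by
  have h := Fin.sum_univ_eq_sum_range (fun i => if j ≤ i then 1 else 0) k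
  rw [Fintype.card_subtype, Finset.card_filter, h, ← Finset.card_filter]
  have : (Finset.range k).filter (fun i => j ≤ i) = Finset.Ico j k := by
    ext i
    simp [and_comm]
  rw [this, Nat.card_Ico]

theorem firstCoords_le (j : ℕ) : firstCoords S k j ≤ MeasurableSpace.pi :=
  (measurable_pi_iff.2 fun _ => measurable_pi_apply _).comap_le

theorem measurable_firstCoords (j : ℕ) : Measurable[firstCoords S k j]
    (fun (x : Fin k → S) (i : {i : Fin k // (i : ℕ) < j}) => x i) :=
  comap_measurable _

/-- The filtration that reveals the points of an ordered configuration one by one. -/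
def firstCoordsFiltration (S : Type*) [MeasurableSpace S] (k : ℕ) :
    Filtration ℕ (MeasurableSpace.pi : MeasurableSpace (Fin k → S)) where
  seq j := firstCoords S k j
  mono' i j hij := by
    let ψ : ({l : Fin k // (l : ℕ) < j} → S) → ({l : Fin k // (l : ℕ) < i} → S) :=
      fun z l => z ⟨l.1, l.2.trans_le hij⟩
    have hψ : Measurable ψ := measurable_pi_iff.2 fun _ => measurable_pi_apply _
    calc firstCoords S k i = (MeasurableSpace.pi.comap ψ).comap
          (fun (x : Fin k → S) (l : {l : Fin k // (l : ℕ) < j}) => x l) :=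
        (MeasurableSpace.comap_comp (f := ψ)
          (g := fun (x : Fin k → S) (l : {l : Fin k // (l : ℕ) < j}) => x l)).symm
      _ ≤ firstCoords S k j := MeasurableSpace.comap_mono hψ.comap_le
  le' := firstCoords_le

theorem firstCoords_zero : firstCoords S k 0 = ⊥ := by
  have : (fun (x : Fin k → S) (i : {i : Fin k // (i : ℕ) < 0}) => x i) =
      fun _ i => absurd i.2 (Nat.not_lt_zero _) := by
    ext x i
    exact absurd i.2 (Nat.not_lt_zero _)
  rw [firstCoords, this, MeasurableSpace.comap_const]

theorem firstCoords_self : firstCoords S k k = MeasurableSpace.pi := by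
  refine le_antisymm (firstCoords_le k) ?_
  exact iSup_le fun i => measurable_iff_comap_le.1
    ((measurable_pi_apply (⟨i, i.2⟩ : {i : Fin k // (i : ℕ) < k})).comp (measurable_firstCoords k))

theorem measurable_const_add_measure (c : Measure S) : Measurable fun ρ : Measure S => c + ρ :=
  Measure.measurable_of_measurable_coe _ fun B hB => by
    simpa using (Measure.measurable_coe hB).const_add (c B)

theorem measurable_residual (j : ℕ) : Measurable
    (fun y : Fin k → S => ∑ i : {i : Fin k // j ≤ (i : ℕ)}, Measure.dirac (y i)) :=
  (measurable_sum_dirac Finset.univ).comp (measurable_pi_iff.2 fun _ => measurable_pi_apply _)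

variable {Ω : Type*} [MeasurableSpace Ω] [StandardBorelSpace S] {P : Measure Ω}

instance [IsFiniteMeasure P] (Z : Ω → Measure S) (j : ℕ) (x : Fin k → S) :
    IsProbabilityMeasure (residualLaw P Z k j x) :=
  Measure.isProbabilityMeasure_map (measurable_residual j).aemeasurable

theorem ae_residualLaw [IsFiniteMeasure P] (Z : Ω → Measure S) (j : ℕ) (x : Fin k → S) :
    ∀ᵐ ρ ∂residualLaw P Z k j x,
      IsCountingMeasure ρ ∧ ρ Set.univ = ((k - j : ℕ) : ℝ≥0∞) := by
  rw [residualLaw, ae_map_iff (measurable_residual j).aemeasurable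
    (measurableSet_isCountingMeasure (k - j))]
  refine ae_of_all _ fun y => ⟨isCountingMeasure_sum_dirac _ _, ?_⟩
  simp [card_subtype_le]

/-- Revealing one more point of a process with the stochastic covering property moves the
conditional expectation of a Lipschitz functional by at most `2`. -/
theorem abs_integral_condExpKernel_sub_le [IsFiniteMeasure P] {Z : Ω → Measure S}
    (hS : HasSCP P Z k) {f : Measure S → ℝ} (hfm : Measurable f) (hf : IsLipschitzOneTV k f)
    {j : ℕ} (hj : j < k) :
    ∀ᵐ x ∂orderedLaw P Z k,
      |∫ y, f (∑ i, Measure.dirac (y i)) ∂condExpKernel (orderedLaw P Z k)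
          (firstCoords S k (j + 1)) x -
        ∫ y, f (∑ i, Measure.dirac (y i)) ∂condExpKernel (orderedLaw P Z k)
          (firstCoords S k j) x| ≤ 2 := by
  have hfib : ∀ l, ∀ᵐ x ∂orderedLaw P Z k,
      ∀ᵐ y ∂condExpKernel (orderedLaw P Z k) (firstCoords S k l) x,
        (fun (i : {i : Fin k // (i : ℕ) < l}) => y i) = fun (i : {i : Fin k // (i : ℕ) < l}) => x i := fun l =>
    condExpKernel_ae_eq_of_measurable (firstCoords_le l) (measurable_firstCoords l)
  filter_upwards [hS j hj, hfib j, hfib (j + 1)] with x ⟨π, hπ1, hπ2, hπ⟩ hx1 hx2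
  let c : ℕ → Measure S := fun l => ∑ i : {i : Fin k // (i : ℕ) < l}, Measure.dirac (x i)
  have hcc : ∀ l, IsCountingMeasure (c l) := fun l => isCountingMeasure_sum_dirac _ _
  have hck : ∀ l ≤ k, ∀ ρ : Measure S, ρ Set.univ = ((k - l : ℕ) : ℝ≥0∞) →
      (c l + ρ) Set.univ = (k : ℝ≥0∞) := by
    intro l hl ρ hρ
    have h1 := congrArg (fun μ : Measure S => μ Set.univ) (sum_dirac_split l x)
    simp only [Measure.add_apply] at h1 ⊢
    rw [hρ, ← card_subtype_le, ← Finset.card_univ,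
      ← sum_dirac_univ Finset.univ (fun i : {i : Fin k // l ≤ (i : ℕ)} => x i), ← h1]
    simp
  have hmeas : ∀ l, Measurable fun ρ => f (c l + ρ) := fun l =>
    hfm.comp (measurable_const_add_measure _)
  have hval : ∀ l, (∀ᵐ y ∂condExpKernel (orderedLaw P Z k) (firstCoords S k l) x,
      (fun (i : {i : Fin k // (i : ℕ) < l}) => y i) = fun (i : {i : Fin k // (i : ℕ) < l}) => x i) →
      ∫ y, f (∑ i, Measure.dirac (y i)) ∂condExpKernel (orderedLaw P Z k) (firstCoords S k l) x =
        ∫ ρ, f (c l + ρ) ∂residualLaw P Z k l x := by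
    intro l hl
    rw [residualLaw, integral_map (measurable_residual l).aemeasurable
      (hmeas l).aestronglyMeasurable]
    refine integral_congr_ae ?_
    filter_upwards [hl] with y hy
    rw [sum_dirac_split l y]
    congr 2
    exact Finset.sum_congr rfl fun i _ => by rw [← congrFun hy i]
  have hint : ∀ l ≤ k, Integrable (fun ρ => f (c l + ρ)) (residualLaw P Z k l x) := by
    intro l hl
    refine Integrable.of_bound (hmeas l).aestronglyMeasurable
      (|f (∑ i, Measure.dirac (x i))| + 2 * k) ?_
    filter_upwards [ae_residualLaw Z l x] with ρ hρ
    have := hf.abs_sub_le ((hcc l).add hρ.1)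
      (isCountingMeasure_sum_dirac Finset.univ x) (hck l hl ρ hρ.2) (by simp)
    have h2 := abs_sub_abs_le_abs_sub (f (c l + ρ)) (f (∑ i, Measure.dirac (x i)))
    rw [Real.norm_eq_abs]
    linarith
  rw [hval j hx1, hval (j + 1) hx2, abs_sub_comm]
  refine abs_integral_sub_integral_le_of_coupling hπ1 hπ2 (hint j hj.le) (hint (j + 1) hj) ?_
  have h1 : ∀ᵐ p ∂π, IsCountingMeasure p.1 ∧ p.1 Set.univ = ((k - j : ℕ) : ℝ≥0∞) :=
    ae_of_ae_map measurable_fst.aemeasurable (hπ1 ▸ ae_residualLaw Z j x)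
  have h2 : ∀ᵐ p ∂π, IsCountingMeasure p.2 ∧ p.2 Set.univ = ((k - (j + 1) : ℕ) : ℝ≥0∞) :=
    ae_of_ae_map measurable_snd.aemeasurable (hπ2 ▸ ae_residualLaw Z (j + 1) x)
  filter_upwards [hπ, h1, h2] with p hp hp1 hp2
  -- The masses `k - j` and `k - (j + 1)` differ since `j < k`, which rules out the equality case of
  -- the covering.
  have hne : p.1 ≠ p.2 := by
    intro h
    have h3 := hp1.2
    rw [h, hp2.2] at h3
    have h4 : k - (j + 1) = k - j := by exact_mod_cast h3
    omega
  obtain ⟨z, hz⟩ := hp.resolve_left hne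
  have hcs : c (j + 1) = c j + Measure.dirac (x ⟨j, hj⟩) := sum_dirac_lt_succ hj x
  -- Both configurations share `c j + p.2` and have one further point: `z` on one side, `x ⟨j, hj⟩`
  -- on the other.
  rw [hz, hcs, ← add_assoc, add_assoc (c j) (Measure.dirac _) p.2, add_comm (Measure.dirac _) p.2,
    ← add_assoc]
  refine hf.abs_sub_add_dirac_le ((hcc j).add hp2.1) _ _ ?_
  have h5 := hck j hj.le p.1 hp1.2
  rw [hz] at h5
  simpa [add_assoc] using h5

end

section

variable {S : Type*} [MeasurableSpace S] [StandardBorelSpace S] {k : ℕ}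
  {Ω : Type*} [MeasurableSpace Ω] {P : Measure Ω} [IsProbabilityMeasure P] {Z : Ω → Measure S}

/-- Concentration of the Lipschitz functionals that are measurable on the space of all measures. -/
theorem concentration_of_measurable (hZ : IsPointProcess Z) (hk : IsHomogeneous P Z k)
    (hS : HasSCP P Z k) {f : Measure S → ℝ} (hfm : Measurable f) (hf : IsLipschitzOneTV k f) :
    Integrable (fun ω => f (Z ω)) P ∧ ∀ a : ℝ, 0 ≤ a →
      P.real {ω | a ≤ f (Z ω) - ∫ ω', f (Z ω') ∂P} ≤ Real.exp (-(a ^ 2 / (8 * (k : ℝ)))) := by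
  have := isProbabilityMeasure_orderedLaw P hZ hk
  set Q := orderedLaw P Z k with hQ
  let Φ : (Fin k → S) → Measure S := fun y => ∑ i, Measure.dirac (y i)
  have hΦ : Measurable Φ := measurable_sum_dirac Finset.univ
  have hmap : Q.map Φ = P.map Z := map_orderedLaw P hZ hk
  obtain ⟨y₀⟩ := nonempty_of_isProbabilityMeasure Q
  have hg : Integrable (fun y => f (Φ y)) Q := by
    refine Integrable.of_bound (hfm.comp hΦ).aestronglyMeasurable (|f (Φ y₀)| + 2 * k)
      (ae_of_all _ fun y => ?_)
    have h1 := hf.abs_sub_le (isCountingMeasure_sum_dirac Finset.univ y)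
      (isCountingMeasure_sum_dirac Finset.univ y₀) (by simp) (by simp)
    have h2 := abs_sub_abs_le_abs_sub (f (Φ y)) (f (Φ y₀))
    rw [Real.norm_eq_abs]
    linarith
  have hgm : Integrable f (P.map Z) := by
    rw [← hmap]
    exact (integrable_map_measure hfm.aestronglyMeasurable hΦ.aemeasurable).2 hg
  refine ⟨hgm.comp_measurable hZ.measurable, fun a ha => ?_⟩
  have hE : ∫ ω, f (Z ω) ∂P = ∫ y, f (Φ y) ∂Q := by
    rw [← integral_map hZ.measurable.aemeasurable hfm.aestronglyMeasurable, ← hmap,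
      integral_map hΦ.aemeasurable hfm.aestronglyMeasurable]
  have hset : ∀ c : ℝ, P.real {ω | a ≤ f (Z ω) - c} = Q.real {y | a ≤ f (Φ y) - c} := by
    intro c
    have hB : MeasurableSet {μ : Measure S | a ≤ f μ - c} :=
      measurableSet_le measurable_const (hfm.sub_const c)
    have h1 : P {ω | a ≤ f (Z ω) - c} = P.map Z {μ | a ≤ f μ - c} :=
      (Measure.map_apply hZ.measurable hB).symm
    have h2 : Q {y | a ≤ f (Φ y) - c} = Q.map Φ {μ | a ≤ f μ - c} :=
      (Measure.map_apply hΦ hB).symm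
    rw [Measure.real, Measure.real, h1, h2, hmap]
  rw [hset, hE]
  have hdiff : ∀ j < k, ∀ᵐ y ∂Q, |(Q[fun y => f (Φ y) | firstCoordsFiltration S k (j + 1)]) y -
      (Q[fun y => f (Φ y) | firstCoordsFiltration S k j]) y| ≤ 2 := by
    intro j hj
    filter_upwards [abs_integral_condExpKernel_sub_le hS hfm hf hj,
      condExp_ae_eq_integral_condExpKernel (firstCoords_le j) hg,
      condExp_ae_eq_integral_condExpKernel (firstCoords_le (j + 1)) hg] with y h1 h2 h3
    exact (congrArg abs (congrArg₂ (· - ·) h3 h2)).trans_le h1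
  refine (measureReal_sub_integral_ge_le_of_condExp_diff_le (firstCoordsFiltration S k) hg
    firstCoords_zero ?_ zero_le_two hdiff ha).trans (le_of_eq ?_)
  · have : (firstCoordsFiltration S k k : MeasurableSpace (Fin k → S)) = MeasurableSpace.pi :=
      firstCoords_self
    rw [this]
    exact (hfm.comp hΦ).stronglyMeasurable
  · congr 1
    rw [neg_div]
    congr 2
    ring

/-- The subtype carries the induced σ-algebra, so `f` extends from it to a measurable `g` on all
measures; `g` inherits the Lipschitz bound and equals `f` almost surely along `Z`. -/
theorem concentration_of_hasSCP (hZ : IsPointProcess Z) (hk : IsHomogeneous P Z k)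
    (hS : HasSCP P Z k) {f : Measure S → ℝ}
    (hfm : Measurable (fun μ : {μ : Measure S //
      IsCountingMeasure μ ∧ μ Set.univ = (k : ℝ≥0∞)} => f μ))
    (hf : IsLipschitzOneTV k f) :
    Integrable (fun ω => f (Z ω)) P ∧ ∀ a : ℝ, 0 ≤ a →
      P.real {ω | a ≤ f (Z ω) - ∫ ω', f (Z ω') ∂P} ≤ Real.exp (-(a ^ 2 / (8 * (k : ℝ)))) := by
  obtain ⟨g, hgm, hg⟩ := Measurable.exists_eq_measurable_comp (f := Subtype.val) hfm
  have hfg : ∀ μ : Measure S, IsCountingMeasure μ → μ Set.univ = (k : ℝ≥0∞) → f μ = g μ :=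
    fun μ h1 h2 => congrFun hg ⟨μ, h1, h2⟩
  have hgL : IsLipschitzOneTV k g := by
    intro μ ν _ _ hμ hν hμk hνk
    rw [← hfg μ hμ hμk, ← hfg ν hν hνk]
    exact hf μ ν hμ hν hμk hνk
  have hae : (fun ω => g (Z ω)) =ᵐ[P] fun ω => f (Z ω) := by
    filter_upwards [hk] with ω hω
    exact (hfg _ (hZ.counting ω) hω).symm
  obtain ⟨h1, h2⟩ := concentration_of_measurable hZ hk hS hgm hgL
  refine ⟨h1.congr hae, fun a ha => le_trans (le_of_eq ?_) (h2 a ha)⟩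
  rw [integral_congr_ae hae]
  refine measureReal_congr ?_
  filter_upwards [hae] with ω hω
  exact propext (by change a ≤ f (Z ω) - _ ↔ a ≤ g (Z ω) - _; rw [hω])

end

/-! ### Concentration on the Boolean lattice -/

section

/-- **Hoeffding's lemma** for a finite convex combination. -/
theorem sum_mul_exp_le_of_abs_sub_le {ι : Type*} (s : Finset ι) {w c : ι → ℝ}
    (hw : ∀ i ∈ s, 0 ≤ w i) (hw1 : ∑ i ∈ s, w i = 1) {C : ℝ} (hC : 0 ≤ C)
    (hc : ∀ i ∈ s, w i ≠ 0 → |c i - ∑ l ∈ s, w l * c l| ≤ C) (t : ℝ) :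
    ∑ i ∈ s, w i * Real.exp (t * c i) ≤
      Real.exp (C ^ 2 * t ^ 2 / 2) * Real.exp (t * ∑ i ∈ s, w i * c i) := by
  let : MeasurableSpace ι := ⊤
  set M := ∑ i ∈ s, w i * c i with hM
  -- The weights form a probability measure. Indices of weight zero are null, so no bound is needed
  -- there.
  let μ : Measure ι := ∑ i ∈ s, ENNReal.ofReal (w i) • Measure.dirac i
  have hint : ∀ φ : ι → ℝ, ∫ i, φ i ∂μ = ∑ i ∈ s, w i * φ i := by
    intro φ
    rw [integral_finsetSum_measure fun i _ =>
      (integrable_dirac (by simp)).smul_measure ENNReal.ofReal_ne_top]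
    refine Finset.sum_congr rfl fun i hi => ?_
    rw [integral_smul_measure, integral_dirac, ENNReal.toReal_ofReal (hw i hi), smul_eq_mul]
  have : IsProbabilityMeasure μ := by
    refine ⟨?_⟩
    simp only [μ, Measure.finsetSum_apply, Measure.smul_apply, measure_univ, smul_eq_mul, mul_one]
    rw [← ENNReal.ofReal_sum_of_nonneg hw, hw1, ENNReal.ofReal_one]
  have hb : ∀ᵐ i ∂μ, c i - M ∈ Set.Icc (-C) C := by
    rw [ae_iff, Measure.finsetSum_apply, Finset.sum_eq_zero_iff]
    intro i hi
    by_cases h0 : w i = 0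
    · simp [h0]
    · have : i ∉ {i | ¬ c i - M ∈ Set.Icc (-C) C} := by
        simpa [abs_le] using hc i hi h0
      rw [Measure.smul_apply, Measure.dirac_apply' _ MeasurableSpace.measurableSet_top, Set.indicator_of_notMem this,
        smul_zero]
  have h0 : ∫ i, (c i - M) ∂μ = 0 := by
    rw [hint]
    simp only [mul_sub, Finset.sum_sub_distrib, ← Finset.sum_mul, hw1, one_mul, ← hM, sub_self]
  have key := (hasSubgaussianMGF_of_mem_Icc_of_integral_eq_zero
    (measurable_from_top.aemeasurable) hb h0).mgf_le t
  rw [mgf, hint] at key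
  have h1 : ∀ i, w i * Real.exp (t * c i) =
      w i * Real.exp (t * (c i - M)) * Real.exp (t * M) := by
    intro i
    rw [mul_assoc, ← Real.exp_add]
    ring_nf
  simp only [h1, ← Finset.sum_mul]
  refine mul_le_mul_of_nonneg_right (key.trans (le_of_eq ?_)) (Real.exp_pos _).le
  congr 3
  push_cast
  rw [sub_neg_eq_add, Real.norm_of_nonneg (by linarith)]
  ring

variable {n : ℕ} {ν : Measure (Fin n → Bool)}

/-- Valid also when `μ A = 0`, so mixture identities need no case distinction. -/
theorem real_mul_integral_cond {Ω : Type*} [MeasurableSpace Ω] (μ : Measure Ω) [IsFiniteMeasure μ]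
    (A : Set Ω) (φ : Ω → ℝ) : μ.real A * ∫ ω, φ ω ∂μ[|A] = ∫ ω in A, φ ω ∂μ := by
  by_cases h : μ A = 0
  · rw [Measure.restrict_eq_zero.2 h]
    simp [Measure.real, h]
  · rw [ProbabilityTheory.cond, integral_smul_measure, ENNReal.toReal_inv, smul_eq_mul,
      ← mul_assoc, Measure.real, mul_inv_cancel₀, one_mul]
    exact (ENNReal.toReal_pos h (measure_ne_top _ _)).ne'

/-- The strings of `{0,1}^n` that are equal to one on `T`. -/
def onesOn (T : Finset (Fin n)) : Set (Fin n → Bool) := {ω | ∀ i ∈ T, ω i = true}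

/-- The strings of `{0,1}^n` that agree with `x` on `T`. -/
abbrev agreeOn (T : Set (Fin n)) (x : T → Bool) : Set (Fin n → Bool) := T.domRestrict ⁻¹' {x}

/-- The string that agrees with `x` on `T` and with `z` off `T`. -/
noncomputable def glue (T : Set (Fin n)) (x : T → Bool) (z : ↥(Tᶜ) → Bool) : Fin n → Bool := by
  classical
  exact fun i => if h : i ∈ T then x ⟨i, h⟩ else z ⟨i, h⟩

theorem integral_cond_eq_integral_condCube [IsFiniteMeasure ν] (T : Set (Fin n)) (x : T → Bool)
    (f : (Fin n → Bool) → ℝ) :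
    ∫ ω, f ω ∂ν[|agreeOn T x] = ∫ z, f (glue T x z) ∂condCube ν T x := by
  have hm : Measurable (Tᶜ.domRestrict : (Fin n → Bool) → (↥(Tᶜ) → Bool)) :=
    measurable_of_countable _
  rw [condCube, integral_map hm.aemeasurable (measurable_of_countable _).aestronglyMeasurable]
  refine integral_congr_ae ?_
  filter_upwards [ae_cond_mem (μ := ν) (Set.toFinite (agreeOn T x)).measurableSet]
    with ω hω
  congr 1
  ext i
  by_cases h : i ∈ T
  · have := congrFun (show T.domRestrict ω = x from hω) ⟨i, h⟩
    simp [glue, h, ← this]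
  · simp [glue, h]

/-- A covering flips exactly one coordinate: one difference arises on `T` and at most one off `T`.
-/
theorem hammingDist_glue_le_two (T : Set (Fin n)) {x y : T → Bool} (hxy : y ⋖ x)
    {z z' : ↥(Tᶜ) → Bool} (hz : z = z' ∨ z' ⋖ z) :
    hammingDist (glue T y z) (glue T x z') ≤ 2 := by
  classical
  obtain ⟨i, -, hi⟩ := Pi.covBy_iff.1 hxy
  have hz' : ∃ l : Fin n, ∀ j : ↥(Tᶜ), j.1 ≠ l → z j = z' j := by
    rcases hz with rfl | hz
    · exact ⟨i, fun _ _ => rfl⟩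
    · obtain ⟨l, -, hl⟩ := Pi.covBy_iff.1 hz
      exact ⟨l, fun j hj => (hl j fun h => hj (congrArg Subtype.val h)).symm⟩
  obtain ⟨l, hl⟩ := hz'
  refine (Finset.card_le_card (t := {i.1, l}) fun j hj => ?_).trans Finset.card_le_two
  by_contra hj'
  simp only [Finset.mem_insert, Finset.mem_singleton, not_or] at hj'
  refine (Finset.mem_filter.1 hj).2 ?_
  by_cases h : j ∈ T
  · simp only [glue, h, dif_pos]
    exact hi ⟨j, h⟩ fun h' => hj'.1 (congrArg Subtype.val h')
  · simp only [glue, h, dif_neg, not_false_eq_true]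
    exact hl ⟨j, h⟩ hj'.2

variable [IsProbabilityMeasure ν] {f : (Fin n → Bool) → ℝ}

theorem abs_integral_cond_sub_le_two (hS : HasSCPCube ν)
    (hf : ∀ x y, |f x - f y| ≤ (hammingDist x y : ℝ)) (T : Set (Fin n)) {x y : T → Bool}
    (hxy : y ⋖ x) (hx : ν (agreeOn T x) ≠ 0) (hy : ν (agreeOn T y) ≠ 0) :
    |∫ ω, f ω ∂ν[|agreeOn T y] - ∫ ω, f ω ∂ν[|agreeOn T x]| ≤ 2 := by
  obtain ⟨π, h1, h2, hπ⟩ := hS T x y hxy hx hy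
  have hp : ∀ z, ν (agreeOn T z) ≠ 0 → IsProbabilityMeasure (condCube ν T z) := by
    intro z hz
    have := cond_isProbabilityMeasure hz
    exact Measure.isProbabilityMeasure_map (measurable_of_countable _).aemeasurable
  have := hp x hx
  have := hp y hy
  rw [integral_cond_eq_integral_condCube, integral_cond_eq_integral_condCube]
  refine abs_integral_sub_integral_le_of_coupling h1 h2 .of_finite .of_finite ?_
  filter_upwards [hπ] with p hp
  exact (hf _ _).trans (by exact_mod_cast hammingDist_glue_le_two T hxy hp)

/-- Given ones on `T`, split according to `ω i`. The SCP compares the two halves `A` and `B`, and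
the mean over the mixture lies between theirs, hence within `2` of the mean over `A`. -/
theorem abs_integral_cond_onesOn_insert_sub_le (hS : HasSCPCube ν)
    (hf : ∀ x y, |f x - f y| ≤ (hammingDist x y : ℝ)) {T : Finset (Fin n)} {i : Fin n}
    (hi : i ∉ T) (h0 : ν (onesOn (insert i T)) ≠ 0) :
    |∫ ω, f ω ∂ν[|onesOn (insert i T)] - ∫ ω, f ω ∂ν[|onesOn T]| ≤ 2 := by
  classical
  let T' : Set (Fin n) := insert i T
  let x : T' → Bool := fun _ => true
  let y : T' → Bool := fun j => decide (j.1 ≠ i)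
  have hxy : y ⋖ x := by
    refine Pi.covBy_iff.2 ⟨⟨i, Set.mem_insert _ _⟩, by simp [x, y], fun j hj => ?_⟩
    have : j.1 ≠ i := fun h => hj (Subtype.ext h)
    simp [x, y, this]
  have hA : onesOn (insert i T) = agreeOn T' x := by
    ext ω
    simp [onesOn, agreeOn, T', x, funext_iff]
  set A := onesOn (insert i T) with hAdef
  set B := agreeOn T' y with hBdef
  have hTAB : onesOn T = A ∪ B := by
    ext ω
    simp only [onesOn, agreeOn, hAdef, hBdef, T', y, Set.mem_union, Set.mem_preimage,
      Set.mem_singleton_iff, funext_iff, Set.domRestrict_apply, Subtype.forall,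
      Set.mem_insert_iff, Finset.mem_coe, Finset.mem_insert, forall_eq_or_imp, Set.mem_ofPred_eq]
    have hne : ∀ j ∈ T, j ≠ i := fun j hj h => hi (h ▸ hj)
    constructor
    · intro h
      cases hωi : ω i
      · refine Or.inr fun j hj => ?_
        rcases hj with rfl | hj
        · simp [hωi]
        · simp [hne j hj, h j hj]
      · exact Or.inl ⟨rfl, h⟩
    · rintro (h | h)
      · exact h.2
      · exact fun j hj => by simpa [hne j hj] using h j (Or.inr hj)
  have hdisj : Disjoint A B := by
    rw [hA]
    refine Disjoint.preimage _ (Set.disjoint_singleton.2 fun h => ?_)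
    exact hxy.ne h.symm
  have hBm : MeasurableSet B := (Set.toFinite B).measurableSet
  have hsum : ν.real (onesOn T) = ν.real A + ν.real B := by
    rw [hTAB, measureReal_union hdisj hBm]
  have hApos : 0 < ν.real A := ENNReal.toReal_pos h0 (measure_ne_top _ _)
  have hint : ν.real (onesOn T) * ∫ ω, f ω ∂ν[|onesOn T] =
      ν.real A * ∫ ω, f ω ∂ν[|A] + ν.real B * ∫ ω, f ω ∂ν[|B] := by
    simp only [real_mul_integral_cond]
    rw [hTAB, setIntegral_union hdisj hBm Integrable.of_finite.integrableOn
      Integrable.of_finite.integrableOn]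
  -- Weighting by `ν.real B` absorbs the case of a null `B`, on which the SCP says nothing.
  have hBA : ν.real B * |∫ ω, f ω ∂ν[|B] - ∫ ω, f ω ∂ν[|A]| ≤ ν.real B * 2 := by
    by_cases hB0 : ν B = 0
    · simp [Measure.real, hB0]
    · refine mul_le_mul_of_nonneg_left ?_ measureReal_nonneg
      rw [hA] at h0 ⊢
      exact abs_integral_cond_sub_le_two hS hf T' hxy h0 hB0
  have hB0 : 0 ≤ ν.real B := measureReal_nonneg
  rw [hsum] at hint
  set a := ν.real A
  set b := ν.real B
  set FA := ∫ ω, f ω ∂ν[|A]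
  set FB := ∫ ω, f ω ∂ν[|B]
  set F := ∫ ω, f ω ∂ν[|onesOn T]
  have h3 : (a + b) * (F - FA) = b * (FB - FA) := by linear_combination hint
  have h4 : (a + b) * |F - FA| ≤ (a + b) * 2 := by
    rw [← abs_of_pos (show 0 < a + b by linarith), ← abs_mul, h3, abs_mul, abs_of_nonneg hB0,
      abs_of_pos (show 0 < a + b by linarith)]
    linarith
  rw [abs_sub_comm]
  exact le_of_mul_le_mul_left h4 (by linarith)

/-- Double counting: a string with `k` ones, including those on `T`, has exactly `m` ones off `T`,
so the right-hand side counts it `m` times. -/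
theorem setIntegral_onesOn_mul_eq_sum {k m : ℕ} (hk : IsHomogeneousCube ν k) {T : Finset (Fin n)}
    (hT : T.card + m = k) (φ : (Fin n → Bool) → ℝ) :
    (∫ ω in onesOn T, φ ω ∂ν) * m = ∑ i ∈ Tᶜ, ∫ ω in onesOn (insert i T), φ ω ∂ν := by
  classical
  have hm : ∀ A : Set (Fin n → Bool), MeasurableSet A := fun A => (Set.toFinite A).measurableSet
  simp_rw [← integral_indicator (hm _)]
  rw [← integral_mul_const, ← integral_finsetSum _ fun i _ => Integrable.of_finite]
  refine integral_congr_ae ?_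
  filter_upwards [hk] with ω hω
  have h1 : ∀ i, (onesOn (insert i T)).indicator φ ω =
      (onesOn T).indicator φ ω * if ω i = true then 1 else 0 := by
    intro i
    by_cases h : ω i = true <;> simp [onesOn, Set.indicator_apply, h]
  simp only [h1, ← Finset.mul_sum, Finset.sum_boole]
  by_cases hω' : ω ∈ onesOn T
  · congr 2
    have h2 : Finset.univ.filter (fun i => ω i = true) =
        T ∪ Tᶜ.filter (fun i => ω i = true) := by
      ext i
      by_cases hi : i ∈ T
      · simp [hi, hω' i hi]
      · simp [hi]
    have h3 : Disjoint T (Tᶜ.filter (fun i => ω i = true)) :=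
      disjoint_compl_right.mono_right (Finset.filter_subset _ _)
    rw [h2, Finset.card_union_of_disjoint h3] at hω
    omega
  · simp [Set.indicator_of_notMem hω']

/-- Induction on the number `m` of ones still hidden. Revealing a uniformly random one of them costs
`exp(2t²)`, by Hoeffding's lemma with `C = 2`. -/
theorem integral_exp_cond_onesOn_le {k : ℕ} (hk : IsHomogeneousCube ν k) (hS : HasSCPCube ν)
    (hf : ∀ x y, |f x - f y| ≤ (hammingDist x y : ℝ)) (t : ℝ) (m : ℕ) (T : Finset (Fin n))
    (hT : T.card + m = k) (h0 : ν (onesOn T) ≠ 0) :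
    ∫ ω, Real.exp (t * f ω) ∂ν[|onesOn T] ≤
      Real.exp (2 * m * t ^ 2) * Real.exp (t * ∫ ω, f ω ∂ν[|onesOn T]) := by
  induction m generalizing T with
  | zero =>
    have := cond_isProbabilityMeasure h0
    -- No hidden ones remain, so the string is the indicator of `T`.
    have hconst : ∀ᵐ ω ∂ν[|onesOn T], ω = fun i => decide (i ∈ T) := by
      filter_upwards [ae_cond_mem (μ := ν) (Set.toFinite (onesOn T)).measurableSet,
        cond_absolutelyContinuous.ae_le hk] with ω h1 h2
      have h3 : T = Finset.univ.filter (fun i => ω i = true) :=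
        Finset.eq_of_subset_of_card_le (fun i hi => by simpa using h1 i hi) (by omega)
      ext i
      rw [h3]
      simp
    have hφ : ∀ φ : (Fin n → Bool) → ℝ,
        ∫ ω, φ ω ∂ν[|onesOn T] = φ fun i => decide (i ∈ T) := by
      intro φ
      rw [integral_congr_ae (g := fun _ => φ fun i => decide (i ∈ T))
        (by filter_upwards [hconst] with ω hω; rw [hω])]
      simp
    simp [hφ]
  | succ m ih =>
    have hp : 0 < ν.real (onesOn T) := ENNReal.toReal_pos h0 (measure_ne_top _ _)
    have hm : (0 : ℝ) < (m + 1 : ℕ) := by positivity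
    -- The probability, given ones on `T`, that a uniformly chosen one of the `m + 1` hidden ones
    -- sits at `i`.
    let w : Fin n → ℝ := fun i => ν.real (onesOn (insert i T)) / (ν.real (onesOn T) * (m + 1 : ℕ))
    have hdec : ∀ φ : (Fin n → Bool) → ℝ, ∫ ω, φ ω ∂ν[|onesOn T] =
        ∑ i ∈ Tᶜ, w i * ∫ ω, φ ω ∂ν[|onesOn (insert i T)] := by
      intro φ
      have h1 := setIntegral_onesOn_mul_eq_sum hk hT φ
      simp only [← real_mul_integral_cond] at h1
      have h2 : ∀ i, w i * ∫ ω, φ ω ∂ν[|onesOn (insert i T)] =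
          (ν.real (onesOn (insert i T)) * ∫ ω, φ ω ∂ν[|onesOn (insert i T)]) /
            (ν.real (onesOn T) * (m + 1 : ℕ)) := fun i => by simp only [w]; ring
      simp only [h2, ← Finset.sum_div]
      rw [← h1]
      field_simp
    have hw : ∀ i, 0 ≤ w i := fun i => by positivity
    have hw0 : ∀ i, w i ≠ 0 → ν (onesOn (insert i T)) ≠ 0 := by
      intro i hi h
      simp [w, Measure.real, h] at hi
    have hw1 : ∑ i ∈ Tᶜ, w i = 1 := by
      have := cond_isProbabilityMeasure h0
      have h1 := hdec fun _ => 1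
      rw [integral_const, smul_eq_mul, mul_one, probReal_univ] at h1
      rw [h1]
      refine Finset.sum_congr rfl fun i _ => ?_
      by_cases hi : w i = 0
      · simp [hi]
      · have := cond_isProbabilityMeasure (hw0 i hi)
        simp
    rw [hdec]
    calc ∑ i ∈ Tᶜ, w i * ∫ ω, Real.exp (t * f ω) ∂ν[|onesOn (insert i T)]
        ≤ ∑ i ∈ Tᶜ, w i * (Real.exp (2 * m * t ^ 2) *
            Real.exp (t * ∫ ω, f ω ∂ν[|onesOn (insert i T)])) := by
          refine Finset.sum_le_sum fun i hi => ?_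
          by_cases hwi : w i = 0
          · simp [hwi]
          · refine mul_le_mul_of_nonneg_left (ih _ ?_ (hw0 i hwi)) (hw i)
            rw [Finset.card_insert_of_notMem (Finset.mem_compl.1 hi)]
            omega
      _ = Real.exp (2 * m * t ^ 2) *
            ∑ i ∈ Tᶜ, w i * Real.exp (t * ∫ ω, f ω ∂ν[|onesOn (insert i T)]) := by
          rw [Finset.mul_sum]
          exact Finset.sum_congr rfl fun i _ => by ring
      _ ≤ Real.exp (2 * m * t ^ 2) * (Real.exp (2 ^ 2 * t ^ 2 / 2) *
            Real.exp (t * ∑ i ∈ Tᶜ, w i * ∫ ω, f ω ∂ν[|onesOn (insert i T)])) := by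
          refine mul_le_mul_of_nonneg_left ?_ (Real.exp_pos _).le
          refine sum_mul_exp_le_of_abs_sub_le _ (fun i _ => hw i) hw1 zero_le_two
            (fun i hi hwi => ?_) t
          rw [← hdec]
          exact abs_integral_cond_onesOn_insert_sub_le hS hf (Finset.mem_compl.1 hi) (hw0 i hwi)
      _ = _ := by
          rw [← hdec, ← mul_assoc, ← Real.exp_add]
          congr 2
          push_cast
          ring

theorem concentration_of_hasSCPCube {k : ℕ} (hk : IsHomogeneousCube ν k) (hS : HasSCPCube ν)
    (hf : ∀ x y, |f x - f y| ≤ (hammingDist x y : ℝ)) {a : ℝ} (ha : 0 ≤ a) :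
    ν.real {ω | a ≤ f ω - ∫ ω', f ω' ∂ν} ≤ Real.exp (-(a ^ 2 / (8 * (k : ℝ)))) := by
  -- `exp(2kt²)` is `exp(vt²/2)` with `v = 4k`; the Chernoff bound `exp(-a²/(2v))` then gives the
  -- `8k`.
  have hsub : HasSubgaussianMGF (fun ω => f ω - ∫ ω', f ω' ∂ν) (4 * k) ν := by
    refine ⟨fun t => .of_finite, fun t => ?_⟩
    have huniv : onesOn (∅ : Finset (Fin n)) = Set.univ := by ext; simp [onesOn]
    have h1 := integral_exp_cond_onesOn_le hk hS hf t k ∅ (by simp) (by simp [huniv])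
    rw [huniv, cond_univ] at h1
    have h2 : mgf (fun ω => f ω - ∫ ω', f ω' ∂ν) ν t =
        (∫ ω, Real.exp (t * f ω) ∂ν) * Real.exp (-(t * ∫ ω, f ω ∂ν)) := by
      rw [mgf, ← integral_mul_const]
      refine integral_congr_ae (ae_of_all _ fun ω => ?_)
      simp only [← Real.exp_add]
      ring_nf
    rw [h2]
    refine (mul_le_mul_of_nonneg_right h1 (Real.exp_pos _).le).trans (le_of_eq ?_)
    rw [← Real.exp_add, ← Real.exp_add]
    congr 1
    push_cast
    ring
  refine (hsub.measure_ge_le ha).trans (le_of_eq ?_)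
  congr 1
  push_cast
  rw [neg_div]
  congr 2
  ring

end

theorem mainTheorem4 (k : ℕ) (hk : 0 < k) :
    -- point processes on a standard Borel space
    (∀ (S : Type*) [MeasurableSpace S] [StandardBorelSpace S]
        (Ω : Type*) [MeasurableSpace Ω] (P : Measure Ω) [IsProbabilityMeasure P]
        (Z : Ω → Measure S),
      IsPointProcess Z → IsHomogeneous P Z k → HasSCP P Z k →
      ∀ f : Measure S → ℝ,
        Measurable (fun μ : {μ : Measure S //
          IsCountingMeasure μ ∧ μ Set.univ = (k : ℝ≥0∞)} => f μ) →
        IsLipschitzOneTV k f →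
        Integrable (fun ω => f (Z ω)) P ∧
        ∀ a : ℝ, 0 ≤ a →
          P.real {ω | a ≤ f (Z ω) - ∫ ω', f (Z ω') ∂P} ≤ Real.exp (-(a ^ 2 / (8 * (k : ℝ))))) ∧
    -- the discrete case: measures on the Boolean lattice
    (∀ (n : ℕ) (ν : Measure (Fin n → Bool)) [IsProbabilityMeasure ν],
      IsHomogeneousCube ν k → HasSCPCube ν →
      ∀ f : (Fin n → Bool) → ℝ, (∀ x y, |f x - f y| ≤ (hammingDist x y : ℝ)) →
        ∀ a : ℝ, 0 ≤ a →
          ν.real {ω | a ≤ f ω - ∫ ω', f ω' ∂ν} ≤ Real.exp (-(a ^ 2 / (8 * (k : ℝ))))) :=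
  ⟨fun _ _ _ _ _ _ _ _ hZ hk hS _ hfm hf => concentration_of_hasSCP hZ hk hS hfm hf,
    fun _ _ _ hk hS _ hf _ ha => concentration_of_hasSCPCube hk hS hf ha⟩
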